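/- Let $\mathbb{T}^2=\mathbb{R}^2/\mathbb{Z}^2$ be the flat torus with geodesic distance $\|x-y\|=\min_{k\in\mathbb{Z}^2}|x-y+k|$. For $p>0$ and four points $x_1,\dots,x_4\in\mathbb{T}^2$ consider the Riesz $p$-energy $$E_p(x_1,\dots,x_4)=\sum_{1\le i<j\le 4}\frac{1}{\|x_i-x_j\|^p},$$ with $E_p=+\infty$ if two of the points coincide. For every $p>0$ the energy $E_p$ attains its minimum. Every configuration that is a global minimizer of $E_p$ for some $p>0$ is a global minimizer only for $p$ in a finite interval: the set of all $p>0$ for which it minimizes $E_p$ is bounded. As $p$ varies over $(0,\infty)$, infinitely many distinct global minimizers occur, even after factoring out the symmetries, i.e. when two configurations are identified if one arises from the other by relabeling the points and applying an isometry of $\mathbb{T}^2$. Moreover, the configuration $$S_{\pi/12}=\left\{(0,0),\left(\tfrac{t}{2},\tfrac12\right),\left(\tfrac12,\tfrac{t}{2}\right),\left(\tfrac{1+t}{2},\tfrac{1+t}{2}\right)\right\},\qquad t=\tan\tfrac{\pi}{12},$$ is not a global minimizer of $E_p$ for any $p>0$. -/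

import Mathlib

/-- The flat torus `ℝ² / ℤ²`: the product of two circles of length `1`, with the `ℓ²` product of the
two circle metrics. Its distance is the geodesic distance
`d(x, y) = min_{k ∈ ℤ²} |x - y + k|` of the unit square with opposite sides identified. -/
abbrev FlatTorus : Type := PiLp 2 (fun _ : Fin 2 => UnitAddCircle)

namespace FlatTorus

/-- The point of the torus represented by `(a, b) ∈ ℝ²`. -/
noncomputable def pt (a b : ℝ) : FlatTorus :=
  WithLp.toLp 2 ![(a : UnitAddCircle), (b : UnitAddCircle)]

/-- The Riesz `p`-energy `∑_{i < j} 1 / ‖x i - x j‖ ^ p` of `n` points on the flat torus. It has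
its intended meaning when the points are pairwise distinct; the energy of a configuration with
coinciding points is infinite, and such configurations are left out in `IsRieszMinimizer`. -/
noncomputable def rieszEnergy {n : ℕ} (p : ℝ) (x : Fin n → FlatTorus) : ℝ :=
  ∑ i : Fin n, ∑ j ∈ Finset.Ioi i, 1 / dist (x i) (x j) ^ p

/-- `x` is a global minimizer of the Riesz `p`-energy among all configurations of `n` points
(configurations with coinciding points have infinite energy and never compete). -/
def IsRieszMinimizer {n : ℕ} (p : ℝ) (x : Fin n → FlatTorus) : Prop :=
  Function.Injective x ∧
    ∀ y : Fin n → FlatTorus, Function.Injective y → rieszEnergy p x ≤ rieszEnergy p y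

/-- Two configurations are the same up to symmetry if one is obtained from the other by
relabeling the points and applying an isometry of the torus. -/
def symmetrySetoid (n : ℕ) : Setoid (Fin n → FlatTorus) where
  r x y := ∃ (σ : Equiv.Perm (Fin n)) (g : FlatTorus ≃ᵢ FlatTorus), ∀ i, y i = g (x (σ i))
  iseqv :=
    { refl := fun _ => ⟨1, IsometryEquiv.refl _, fun _ => rfl⟩
      symm := by
        rintro x y ⟨σ, g, h⟩
        refine ⟨σ.symm, g.symm, fun i => ?_⟩
        rw [h, g.symm_apply_apply, Equiv.apply_symm_apply]
      trans := by
        rintro x y z ⟨σ, g, h⟩ ⟨τ, k, h'⟩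
        refine ⟨σ * τ, g.trans k, fun i => ?_⟩
        rw [h', h, IsometryEquiv.trans_apply, Equiv.Perm.mul_apply] }

/-- Configurations of `n` points, modulo relabelings and isometries of the torus. -/
abbrev ConfigurationClass (n : ℕ) : Type := Quotient (symmetrySetoid n)

/-- The one-parameter family `S_α` of four-point configurations, `0 ≤ α ≤ π / 12`. -/
noncomputable def familyS (α : ℝ) : Fin 4 → FlatTorus :=
  ![pt 0 0, pt (Real.tan α / 2) (1 / 2), pt (1 / 2) (Real.tan α / 2),
    pt ((1 + Real.tan α) / 2) ((1 + Real.tan α) / 2)]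

end FlatTorus

namespace FlatTorus

/-! ### Distances on the torus -/

/-! The exponent `p → ∞` favours the best packing, but the best packing is never optimal. Rigidity
(`dist_sq_eq_of_le`): four points with all distances at least `d = √(2 - √3)` have all six distances
equal to `d`, as in `S_{π/12}`. If one configuration minimized the energy for unboundedly many `p`,
comparison with `S_{π/12}`, of energy `6 / d ^ p`, would exclude distances below `d`. It would then
be equidistant with distance `d`, hence would have the energy of `S_{π/12}` at every `p`, and
`S_{π/12}` would be a minimizer too. But `S_{π/12}` is not even critical: along `S_α` the energy has
positive derivative there.

So each configuration is optimal only for bounded `p`. Minimizers exist for all `p > 0` by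
compactness, and finitely many classes would give a common bound, so infinitely many classes occur.

Rigidity is a planar estimate for three points whose first coordinates lie on a half circle
(`triangle_rigid`); sorting the four first coordinates provides such triples. -/

lemma dist_sq_eq (x y : FlatTorus) : dist x y ^ 2 = ‖x 0 - y 0‖ ^ 2 + ‖x 1 - y 1‖ ^ 2 := by
  rw [PiLp.dist_eq_of_L2, Real.sq_sqrt (Finset.sum_nonneg fun _ _ => sq_nonneg _)]
  simp [dist_eq_norm]

lemma norm_coe_le_abs_sub_int (r : ℝ) (k : ℤ) : ‖(r : UnitAddCircle)‖ ≤ |r - k| := by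
  rw [UnitAddCircle.norm_eq]
  exact round_le r k

lemma exists_coe_eq_abs_eq_norm (u : UnitAddCircle) :
    ∃ r : ℝ, (r : UnitAddCircle) = u ∧ |r| = ‖u‖ := by
  obtain ⟨r, rfl⟩ := QuotientAddGroup.mk_surjective u
  refine ⟨r - round r, ?_, ?_⟩
  · have : ((round r : ℝ) : UnitAddCircle) = 0 := by
      rw [AddCircle.coe_eq_zero_iff]
      exact ⟨round r, by simp⟩
    rw [AddCircle.coe_sub, this, sub_zero]
  · exact (UnitAddCircle.norm_eq).symm

lemma norm_le_half (u : UnitAddCircle) : ‖u‖ ≤ 1 / 2 := by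
  simpa using AddCircle.norm_le_half_period (1 : ℝ) (x := u) one_ne_zero

/-- The perimeter of a triangle in the unit circle is at most `1`. -/
lemma norm_add_norm_add_norm_add_le_one (u v : UnitAddCircle) : ‖u‖ + ‖v‖ + ‖u + v‖ ≤ 1 := by
  have hu := norm_le_half u
  have hv := norm_le_half v
  obtain ⟨r, rfl, hr⟩ := exists_coe_eq_abs_eq_norm u
  obtain ⟨s, rfl, hs⟩ := exists_coe_eq_abs_eq_norm v
  rw [← hr] at hu ⊢
  rw [← hs] at hv ⊢
  rw [← AddCircle.coe_add]
  -- The shift 0 serves lifts of opposite signs, the shifts `±1` lifts of equal sign.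
  have h0 := norm_coe_le_abs_sub_int (r + s) 0
  have h1 := norm_coe_le_abs_sub_int (r + s) 1
  have h2 := norm_coe_le_abs_sub_int (r + s) (-1)
  push_cast at h0 h1 h2
  rw [abs_le] at hu hv
  rcases abs_cases r with ⟨e1, _⟩ | ⟨e1, _⟩ <;> rcases abs_cases s with ⟨e2, _⟩ | ⟨e2, _⟩ <;>
    rcases abs_cases (r + s - 0) with ⟨e3, _⟩ | ⟨e3, _⟩ <;>
    rcases abs_cases (r + s - 1) with ⟨e4, _⟩ | ⟨e4, _⟩ <;>
    rcases abs_cases (r + s - -1) with ⟨e5, _⟩ | ⟨e5, _⟩ <;> linarith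

lemma dist_pt {a b c d : ℝ} (h : |a - c| ≤ 1 / 2) (h' : |b - d| ≤ 1 / 2) :
    dist (pt a b) (pt c d) = √((a - c) ^ 2 + (b - d) ^ 2) := by
  have key : ∀ r : ℝ, |r| ≤ 1 / 2 → ‖(r : UnitAddCircle)‖ = |r| := fun r hr =>
    (AddCircle.norm_coe_eq_abs_iff (1 : ℝ) one_ne_zero).2 (by simpa using hr)
  rw [← Real.sqrt_sq (dist_nonneg (x := pt a b)), dist_sq_eq]
  have e0 : (pt a b 0 - pt c d 0 : UnitAddCircle) = ((a - c : ℝ) : UnitAddCircle) := rfl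
  have e1 : (pt a b 1 - pt c d 1 : UnitAddCircle) = ((b - d : ℝ) : UnitAddCircle) := rfl
  rw [e0, e1, key _ h, key _ h', sq_abs, sq_abs]

lemma pt_sub_one (a b : ℝ) : pt (a - 1) (b - 1) = pt a b := by
  unfold pt
  rw [AddCircle.coe_sub, AddCircle.coe_sub, AddCircle.coe_period, sub_zero, sub_zero]

instance : CompactSpace FlatTorus :=
  (WithLp.toLp_surjective (V := ∀ _ : Fin 2, UnitAddCircle) 2).compactSpace
    (PiLp.continuous_toLp 2 _)

/-! ### The optimal packing of four points -/

/-- A point of the first quadrant outside the disc of radius `√(2 - √3)` lies above the chord of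
this disc that spans the angles from `π / 4` to `5 π / 12`. -/
lemma chord_le {u h : ℝ} (hh : 0 ≤ h) (hu : (2 - √3) / 2 ≤ u) (hu' : u ≤ (√3 - 1) / 2)
    (H : 2 - √3 ≤ u ^ 2 + h ^ 2) : 1 / 2 - √3 / 3 * (u - (2 - √3) / 2) ≤ h := by
  have h3 : √3 ^ 2 = 3 := Real.sq_sqrt (by norm_num)
  have key : 0 ≤ (u - (2 - √3) / 2) * ((√3 - 1) / 2 - u) :=
    mul_nonneg (sub_nonneg.2 hu) (sub_nonneg.2 hu')
  refine le_of_sq_le_sq ?_ hh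
  -- The left side is a quadratic in `u` that vanishes at both ends of the chord, where it meets the
  -- circle.
  have : (1 / 2 - √3 / 3 * (u - (2 - √3) / 2)) ^ 2 + u ^ 2 - (2 - √3) =
    -(4 / 3) * ((u - (2 - √3) / 2) * ((√3 - 1) / 2 - u)) := by
    generalize √3 = w at *
    grind
  linarith

/-- The chord lies inside the disc. Together with `chord_le`, this puts a point that attains the
chord bound on the circle. -/
lemma sq_chord_add_sq_le {u : ℝ} (hu : (2 - √3) / 2 ≤ u) (hu' : u ≤ (√3 - 1) / 2) :
    u ^ 2 + (1 / 2 - √3 / 3 * (u - (2 - √3) / 2)) ^ 2 ≤ 2 - √3 := by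
  have h3 : √3 ^ 2 = 3 := Real.sq_sqrt (by norm_num)
  have key : 0 ≤ (u - (2 - √3) / 2) * ((√3 - 1) / 2 - u) :=
    mul_nonneg (sub_nonneg.2 hu) (sub_nonneg.2 hu')
  have : (1 / 2 - √3 / 3 * (u - (2 - √3) / 2)) ^ 2 + u ^ 2 - (2 - √3) =
    -(4 / 3) * ((u - (2 - √3) / 2) * ((√3 - 1) / 2 - u)) := by
    generalize √3 = w at *
    grind
  linarith

/-- Because `2 - √3 - 1/4 = ((2 - √3) / 2) ^ 2`. -/
lemma half_le_of_sq_add_sq {u h : ℝ} (hu : 0 ≤ u) (hh : 0 ≤ h) (hh' : h ≤ 1 / 2)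
    (H : 2 - √3 ≤ u ^ 2 + h ^ 2) : (2 - √3) / 2 ≤ u := by
  have h3 : √3 ^ 2 = 3 := Real.sq_sqrt (by norm_num)
  refine le_of_sq_le_sq ?_ hu
  nlinarith

/-- Here `u`, `v`, `u + v` are horizontal gaps and the `hᵢ` vertical distances, of sum at most 1 by
the perimeter bound. The chord bounds for `h₁`, `h₂` and the bound `(2 - √3) / 2` for `h₃` add up to
`1 + √3 / 3 * (1 / 2 - (u + v))`, so every estimate is an equality. -/
lemma triangle_rigid {u v h₁ h₂ h₃ : ℝ} (hu : 0 ≤ u) (hv : 0 ≤ v) (huv : u + v ≤ 1 / 2)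
    (p₁ : 0 ≤ h₁) (p₂ : 0 ≤ h₂) (p₃ : 0 ≤ h₃) (q₁ : h₁ ≤ 1 / 2) (q₂ : h₂ ≤ 1 / 2)
    (H : h₁ + h₂ + h₃ ≤ 1)
    (H₁ : 2 - √3 ≤ u ^ 2 + h₁ ^ 2) (H₂ : 2 - √3 ≤ v ^ 2 + h₂ ^ 2)
    (H₃ : 2 - √3 ≤ (u + v) ^ 2 + h₃ ^ 2) :
    u + v = 1 / 2 ∧ u ^ 2 + h₁ ^ 2 = 2 - √3 ∧ v ^ 2 + h₂ ^ 2 = 2 - √3 ∧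
      (u + v) ^ 2 + h₃ ^ 2 = 2 - √3 := by
  have h3 : √3 ^ 2 = 3 := Real.sq_sqrt (by norm_num)
  have h3p : 0 < √3 := by positivity
  have hu1 := half_le_of_sq_add_sq hu p₁ q₁ H₁
  have hv1 := half_le_of_sq_add_sq hv p₂ q₂ H₂
  have h31 : (2 - √3) / 2 ≤ h₃ :=
    half_le_of_sq_add_sq p₃ (add_nonneg hu hv) huv (by linarith)
  have c1 := chord_le p₁ hu1 (by linarith) H₁
  have c2 := chord_le p₂ hv1 (by linarith) H₂
  have e : u + v = 1 / 2 := by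
    by_contra hne
    have hlt : 0 < 1 / 2 - (u + v) := sub_pos.2 (lt_of_le_of_ne huv hne)
    have := mul_pos h3p hlt
    linarith
  obtain rfl : v = 1 / 2 - u := by linarith
  have e1 : h₁ = 1 / 2 - √3 / 3 * (u - (2 - √3) / 2) := by linarith
  have e2 : h₂ = 1 / 2 - √3 / 3 * (1 / 2 - u - (2 - √3) / 2) := by linarith
  have e3 : h₃ = (2 - √3) / 2 := by linarith
  refine ⟨e, le_antisymm ?_ H₁, le_antisymm ?_ H₂, ?_⟩
  · rw [e1]
    exact sq_chord_add_sq_le hu1 (by linarith)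
  · rw [e2]
    exact sq_chord_add_sq_le hv1 (by linarith)
  · rw [e, e3]
    linarith

/-- Three points of the torus whose first coordinates lie on a half circle, with distances at least
`√(2 - √3)`, have all their distances equal to this value. -/
lemma dist_sq_eq_of_half_circle {X Y Z : FlatTorus} {a b c : ℝ} (ha : (a : UnitAddCircle) = X 0)
    (hb : (b : UnitAddCircle) = Y 0) (hc : (c : UnitAddCircle) = Z 0) (hab : a ≤ b) (hbc : b ≤ c)
    (hac : c - a ≤ 1 / 2) (hXY : 2 - √3 ≤ dist X Y ^ 2) (hYZ : 2 - √3 ≤ dist Y Z ^ 2)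
    (hXZ : 2 - √3 ≤ dist X Z ^ 2) :
    c - a = 1 / 2 ∧ dist X Y ^ 2 = 2 - √3 ∧ dist Y Z ^ 2 = 2 - √3 ∧ dist X Z ^ 2 = 2 - √3 := by
  have key : ∀ {P Q : FlatTorus} {r s : ℝ}, (r : UnitAddCircle) = P 0 → (s : UnitAddCircle) = Q 0 →
      dist P Q ^ 2 ≤ (s - r) ^ 2 + ‖P 1 - Q 1‖ ^ 2 := by
    intro P Q r s hr hs
    rw [dist_sq_eq, ← hr, ← hs, ← AddCircle.coe_sub]
    have := norm_coe_le_abs_sub_int (r - s) 0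
    rw [Int.cast_zero, sub_zero] at this
    have := pow_le_pow_left₀ (norm_nonneg _) this 2
    rw [sq_abs] at this
    nlinarith
  have k1 := key ha hb
  have k2 := key hb hc
  have k3 := key ha hc
  have per := norm_add_norm_add_norm_add_le_one (X 1 - Y 1) (Y 1 - Z 1)
  rw [sub_add_sub_cancel] at per
  have eac : b - a + (c - b) = c - a := by ring
  obtain ⟨r0, r1, r2, r3⟩ := triangle_rigid (u := b - a) (v := c - b) (by linarith) (by linarith)
    (by linarith) (norm_nonneg _) (norm_nonneg _) (norm_nonneg _) (norm_le_half _)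
    (norm_le_half _) per (hXY.trans k1) (hYZ.trans k2) (by rw [eac]; exact hXZ.trans k3)
  rw [eac] at r0 r3
  exact ⟨r0, le_antisymm (k1.trans r1.le) hXY, le_antisymm (k2.trans r2.le) hYZ,
    le_antisymm (k3.trans r3.le) hXZ⟩

lemma dist_sq_eq_of_sorted {x : Fin 4 → FlatTorus} {a : Fin 4 → ℝ}
    (ha : ∀ i, (a i : UnitAddCircle) = x i 0) (mono : Monotone a) (hlt : a 3 ≤ a 0 + 1)
    (H : ∀ i j, i ≠ j → 2 - √3 ≤ dist (x i) (x j) ^ 2) :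
    ∀ i j, i ≠ j → dist (x i) (x j) ^ 2 = 2 - √3 := by
  -- Shifting by a period lets triples wrap around the circle.
  have ha' : ∀ i, ((a i + 1 : ℝ) : UnitAddCircle) = x i 0 := fun i => by
    rw [AddCircle.coe_add, AddCircle.coe_period, add_zero, ha]
  have m01 : a 0 ≤ a 1 := mono (by decide)
  have m12 : a 1 ≤ a 2 := mono (by decide)
  have m23 : a 2 ≤ a 3 := mono (by decide)
  have A := dist_sq_eq_of_half_circle (ha 0) (ha 1) (ha 2) m01 m12
  have B := dist_sq_eq_of_half_circle (ha 2) (ha 3) (ha' 0) m23 hlt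
  have C := dist_sq_eq_of_half_circle (ha 1) (ha 2) (ha 3) m12 m23
  have D := dist_sq_eq_of_half_circle (ha 3) (ha' 0) (ha' 1) hlt (by linarith)
  have A' := fun h => A h (H _ _ (by decide)) (H _ _ (by decide)) (H _ _ (by decide))
  have B' := fun h => B h (H _ _ (by decide)) (H _ _ (by decide)) (H _ _ (by decide))
  have C' := fun h => C h (H _ _ (by decide)) (H _ _ (by decide)) (H _ _ (by decide))
  have D' := fun h => D h (H _ _ (by decide)) (H _ _ (by decide)) (H _ _ (by decide))
  -- One of the two arcs between points 0 and 2 has length at most `1 / 2`; rigidity of the triple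
  -- on it makes the length exactly `1 / 2`.
  have h02 : a 2 - a 0 = 1 / 2 := by
    rcases le_total (a 2 - a 0) (1 / 2) with h | h
    · exact (A' h).1
    · have := (B' (by linarith)).1
      linarith
  have h13 : a 3 - a 1 = 1 / 2 := by
    rcases le_total (a 3 - a 1) (1 / 2) with h | h
    · exact (C' h).1
    · have := (D' (by linarith)).1
      linarith
  obtain ⟨-, d01, d12, d02⟩ := A' h02.le
  obtain ⟨-, d23, d30, -⟩ := B' (by linarith)
  obtain ⟨-, -, -, d13⟩ := C' h13.le
  have key : ∀ i j, i < j → dist (x i) (x j) ^ 2 = 2 - √3 := by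
    intro i j hij
    rw [dist_comm] at d30
    fin_cases i <;> fin_cases j <;> first | exact absurd hij (by decide) | assumption
  intro i j hij
  rcases lt_or_gt_of_ne hij with h | h
  · exact key i j h
  · rw [dist_comm]
    exact key j i h

/-- Four points of the torus with distances at least `√(2 - √3)` have all their distances equal to
this value. -/
theorem dist_sq_eq_of_le {x : Fin 4 → FlatTorus}
    (H : ∀ i j, i ≠ j → 2 - √3 ≤ dist (x i) (x j) ^ 2) :
    ∀ i j, i ≠ j → dist (x i) (x j) ^ 2 = 2 - √3 := by
  set a : Fin 4 → ℝ := fun i => AddCircle.equivIco (1 : ℝ) 0 (x i 0) with ha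
  have hmem : ∀ i, 0 ≤ a i ∧ a i < 0 + 1 := fun i => (AddCircle.equivIco (1 : ℝ) 0 (x i 0)).2
  have hcoe : ∀ i, (a i : UnitAddCircle) = x i 0 := fun i => AddCircle.coe_equivIco
  set σ := Tuple.sort a
  have main := dist_sq_eq_of_sorted (x := x ∘ σ) (a := a ∘ σ) (fun i => hcoe (σ i))
    (Tuple.monotone_sort a) (by have := hmem (σ 3); have := hmem (σ 0); simp; linarith)
    (fun i j hij => H _ _ (σ.injective.ne hij))
  intro i j hij
  simpa using main (σ.symm i) (σ.symm j) (σ.symm.injective.ne hij)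

/-! ### The Riesz energy -/

lemma one_div_dist_rpow_le_rieszEnergy {n : ℕ} (p : ℝ) (x : Fin n → FlatTorus) {i j : Fin n}
    (h : i ≠ j) : 1 / dist (x i) (x j) ^ p ≤ rieszEnergy p x := by
  have key : ∀ i j : Fin n, i < j → 1 / dist (x i) (x j) ^ p ≤ rieszEnergy p x := by
    intro i j hij
    have nonneg : ∀ i j : Fin n, 0 ≤ 1 / dist (x i) (x j) ^ p := fun i j => by positivity
    calc 1 / dist (x i) (x j) ^ p ≤ ∑ j ∈ Finset.Ioi i, 1 / dist (x i) (x j) ^ p :=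
          Finset.single_le_sum (f := fun j => 1 / dist (x i) (x j) ^ p) (fun k _ => nonneg i k)
            (Finset.mem_Ioi.2 hij)
      _ ≤ rieszEnergy p x :=
          Finset.single_le_sum (f := fun i => ∑ j ∈ Finset.Ioi i, 1 / dist (x i) (x j) ^ p)
            (fun k _ => Finset.sum_nonneg fun l _ => nonneg k l) (Finset.mem_univ i)
  rcases lt_or_gt_of_ne h with h | h
  · exact key i j h
  · rw [dist_comm]
    exact key j i h

lemma rieszEnergy_four (p : ℝ) (x : Fin 4 → FlatTorus) :
    rieszEnergy p x = 1 / dist (x 0) (x 1) ^ p + 1 / dist (x 0) (x 2) ^ p +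
      1 / dist (x 0) (x 3) ^ p + 1 / dist (x 1) (x 2) ^ p + 1 / dist (x 1) (x 3) ^ p +
      1 / dist (x 2) (x 3) ^ p := by
  have e0 : Finset.Ioi (0 : Fin 4) = {1, 2, 3} := by decide
  have e1 : Finset.Ioi (1 : Fin 4) = {2, 3} := by decide
  have e2 : Finset.Ioi (2 : Fin 4) = {3} := by decide
  have e3 : Finset.Ioi (3 : Fin 4) = ∅ := by decide
  rw [rieszEnergy, Fin.sum_univ_four, e0, e1, e2, e3]
  rw [Finset.sum_insert (by decide), Finset.sum_pair (by decide), Finset.sum_pair (by decide),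
    Finset.sum_singleton, Finset.sum_empty]
  ring

/-- The energy of `n` points attains its minimum. -/
theorem exists_isRieszMinimizer {n : ℕ} {p : ℝ} (hp : 0 < p) {x₀ : Fin n → FlatTorus}
    (hx₀ : Function.Injective x₀) : ∃ x : Fin n → FlatTorus, IsRieszMinimizer p x := by
  set M := rieszEnergy p x₀ + 1 with hM
  have hMpos : 0 < M := by
    have : 0 ≤ rieszEnergy p x₀ :=
      Finset.sum_nonneg fun i _ => Finset.sum_nonneg fun j _ => by positivity
    linarith
  -- At distance `ε` a single pair already contributes `M`, so configurations outside the compact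
  -- set `K` have more energy than `x₀`.
  set ε := M ^ (-(1 / p)) with hε
  have hεpos : 0 < ε := Real.rpow_pos_of_pos hMpos _
  have hεp : 1 / ε ^ p = M := by
    rw [hε, ← Real.rpow_mul hMpos.le, neg_mul, one_div_mul_cancel hp.ne', Real.rpow_neg_one,
      one_div, inv_inv]
  set K : Set (Fin n → FlatTorus) := {x | ∀ i j, i ≠ j → ε ≤ dist (x i) (x j)} with hK
  have hKinj : ∀ x ∈ K, Function.Injective x := by
    intro x hx i j hij
    by_contra hne
    have := hx i j hne
    rw [hij, dist_self] at this
    linarith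
  have hKc : IsCompact K := by
    have : IsClosed K := by
      simp only [hK, Set.ofPred_forall]
      refine isClosed_iInter fun i => isClosed_iInter fun j => isClosed_iInter fun _ => ?_
      exact isClosed_le continuous_const (by fun_prop)
    exact this.isCompact
  have hout : ∀ y, Function.Injective y → y ∉ K → M < rieszEnergy p y := by
    intro y hy hyK
    simp only [hK, Set.mem_ofPred_eq, not_forall, not_le] at hyK
    obtain ⟨i, j, hij, hlt⟩ := hyK
    refine lt_of_lt_of_le ?_ (one_div_dist_rpow_le_rieszEnergy p y hij)
    have hd : 0 < dist (y i) (y j) := dist_pos.2 (hy.ne hij)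
    rw [← hεp]
    exact one_div_lt_one_div_of_lt (Real.rpow_pos_of_pos hd p) (Real.rpow_lt_rpow hd.le hlt hp)
  have hx₀K : x₀ ∈ K := by
    by_contra h
    have := hout x₀ hx₀ h
    linarith
  have hcont : ContinuousOn (rieszEnergy (n := n) p) K := by
    unfold rieszEnergy
    refine continuousOn_finsetSum _ fun i _ => continuousOn_finsetSum _ fun j hj => ?_
    have hne : i ≠ j := (Finset.mem_Ioi.1 hj).ne
    have hd : ContinuousOn (fun x : Fin n → FlatTorus => dist (x i) (x j)) K := by fun_prop
    refine continuousOn_const.div (hd.rpow_const fun x _ => Or.inr hp.le) fun x hx => ?_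
    exact (Real.rpow_pos_of_pos (hεpos.trans_le (hx i j hne)) p).ne'
  obtain ⟨x, hxK, hmin⟩ := hKc.exists_isMinOn ⟨x₀, hx₀K⟩ hcont
  refine ⟨x, hKinj x hxK, fun y hy => ?_⟩
  by_cases hyK : y ∈ K
  · exact hmin hyK
  · have h1 : rieszEnergy p x ≤ rieszEnergy p x₀ := hmin hx₀K
    have := hout y hy hyK
    linarith

lemma rieszEnergy_eq_of_symm {n : ℕ} (p : ℝ) {x y : Fin n → FlatTorus} (σ : Equiv.Perm (Fin n))
    (g : FlatTorus ≃ᵢ FlatTorus) (h : ∀ i, y i = g (x (σ i))) :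
    rieszEnergy p y = rieszEnergy p x := by
  -- Relabeling does not preserve `i < j`, so the sum is passed to ordered pairs.
  have double : ∀ z : Fin n → FlatTorus, 2 * rieszEnergy p z =
      ∑ i, ∑ j, if i = j then 0 else 1 / dist (z i) (z j) ^ p := by
    intro z
    have e : rieszEnergy p z = ∑ i, ∑ j, if i < j then 1 / dist (z i) (z j) ^ p else 0 := by
      unfold rieszEnergy
      refine Finset.sum_congr rfl fun i _ => ?_
      rw [← Finset.sum_filter]
      refine Finset.sum_congr ?_ fun _ _ => rfl
      ext j
      simp
    have e' : rieszEnergy p z = ∑ i, ∑ j, if j < i then 1 / dist (z i) (z j) ^ p else 0 := by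
      rw [e, Finset.sum_comm]
      simp_rw [dist_comm]
    rw [two_mul]
    nth_rewrite 1 [e]
    rw [e', ← Finset.sum_add_distrib]
    refine Finset.sum_congr rfl fun i _ => ?_
    rw [← Finset.sum_add_distrib]
    refine Finset.sum_congr rfl fun j _ => ?_
    rcases lt_trichotomy i j with hij | hij | hij
    · simp [hij, hij.ne, hij.not_gt]
    · simp [hij]
    · simp [hij, hij.ne', hij.not_gt]
  have key : 2 * rieszEnergy p y = 2 * rieszEnergy p x := by
    rw [double, double,
      ← Equiv.sum_comp σ (fun i => ∑ j, if i = j then 0 else 1 / dist (x i) (x j) ^ p)]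
    refine Finset.sum_congr rfl fun i _ => ?_
    rw [← Equiv.sum_comp σ (fun j => if σ i = j then 0 else 1 / dist (x (σ i)) (x j) ^ p)]
    refine Finset.sum_congr rfl fun j _ => ?_
    simp [h, g.isometry.dist_eq]
  linarith

lemma IsRieszMinimizer.of_symm {n : ℕ} {p : ℝ} {x y : Fin n → FlatTorus}
    (hx : IsRieszMinimizer p x) (h : (symmetrySetoid n).r x y) : IsRieszMinimizer p y := by
  obtain ⟨σ, g, h⟩ := h
  refine ⟨fun i j hij => ?_, fun z hz => ?_⟩
  · rw [h, h] at hij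
    exact σ.injective (hx.1 (g.injective hij))
  · rw [rieszEnergy_eq_of_symm p σ g h]
    exact hx.2 z hz

/-! ### The family `S_α` -/

lemma tan_pi_div_twelve : Real.tan (Real.pi / 12) = 2 - √3 := by
  have h3 : √3 ^ 2 = 3 := Real.sq_sqrt (by norm_num)
  have hc : 0 < Real.cos (Real.pi / 12) :=
    Real.cos_pos_of_mem_Ioo ⟨by linarith [Real.pi_pos], by linarith [Real.pi_pos]⟩
  have hs : Real.sin (Real.pi / 6) = 2 * Real.sin (Real.pi / 12) * Real.cos (Real.pi / 12) := by
    rw [← Real.sin_two_mul]; congr 1; ring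
  have hc2 : Real.cos (Real.pi / 6) = 2 * Real.cos (Real.pi / 12) ^ 2 - 1 := by
    rw [← Real.cos_two_mul]; congr 1; ring
  rw [Real.sin_pi_div_six] at hs
  rw [Real.cos_pi_div_six] at hc2
  rw [Real.tan_eq_sin_div_cos, div_eq_iff hc.ne']
  have : 2 * Real.cos (Real.pi / 12) ≠ 0 := by positivity
  refine mul_left_cancel₀ this ?_
  nlinarith

/-- The family `S_α` in terms of `s = tan α`. -/
noncomputable def familyTan (s : ℝ) : Fin 4 → FlatTorus :=
  ![pt 0 0, pt (s / 2) (1 / 2), pt (1 / 2) (s / 2), pt ((1 + s) / 2) ((1 + s) / 2)]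

lemma familyS_pi_div_twelve : familyS (Real.pi / 12) = familyTan (2 - √3) := by
  rw [familyS, tan_pi_div_twelve, familyTan]

lemma dist_familyTan {s : ℝ} (h0 : 0 < s) (h1 : s < 1 / 2) :
    dist (familyTan s 0) (familyTan s 1) = √((1 + s ^ 2) / 4) ∧
    dist (familyTan s 0) (familyTan s 2) = √((1 + s ^ 2) / 4) ∧
    dist (familyTan s 0) (familyTan s 3) = √((1 - s) ^ 2 / 2) ∧
    dist (familyTan s 1) (familyTan s 2) = √((1 - s) ^ 2 / 2) ∧
    dist (familyTan s 1) (familyTan s 3) = √((1 + s ^ 2) / 4) ∧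
    dist (familyTan s 2) (familyTan s 3) = √((1 + s ^ 2) / 4) := by
  refine ⟨?_, ?_, ?_, ?_, ?_, ?_⟩
  · change dist (pt 0 0) (pt (s / 2) (1 / 2)) = _
    rw [dist_pt (by rw [abs_le]; constructor <;> linarith) (by rw [abs_le]; constructor <;> linarith)]
    congr 1; ring
  · change dist (pt 0 0) (pt (1 / 2) (s / 2)) = _
    rw [dist_pt (by rw [abs_le]; constructor <;> linarith) (by rw [abs_le]; constructor <;> linarith)]
    congr 1; ring
  · change dist (pt 0 0) (pt ((1 + s) / 2) ((1 + s) / 2)) = _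
    -- The representative shifted by `(-1, -1)` has coordinates of size at most `1 / 2`.
    rw [← pt_sub_one ((1 + s) / 2),
      dist_pt (by rw [abs_le]; constructor <;> linarith) (by rw [abs_le]; constructor <;> linarith)]
    congr 1; ring
  · change dist (pt (s / 2) (1 / 2)) (pt (1 / 2) (s / 2)) = _
    rw [dist_pt (by rw [abs_le]; constructor <;> linarith) (by rw [abs_le]; constructor <;> linarith)]
    congr 1; ring
  · change dist (pt (s / 2) (1 / 2)) (pt ((1 + s) / 2) ((1 + s) / 2)) = _
    rw [dist_pt (by rw [abs_le]; constructor <;> linarith) (by rw [abs_le]; constructor <;> linarith)]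
    congr 1; ring
  · change dist (pt (1 / 2) (s / 2)) (pt ((1 + s) / 2) ((1 + s) / 2)) = _
    rw [dist_pt (by rw [abs_le]; constructor <;> linarith) (by rw [abs_le]; constructor <;> linarith)]
    congr 1; ring

lemma familyTan_injective {s : ℝ} (h0 : 0 < s) (h1 : s < 1 / 2) :
    Function.Injective (familyTan s) := by
  obtain ⟨d01, d02, d03, d12, d13, d23⟩ := dist_familyTan h0 h1
  have hA : 0 < √((1 + s ^ 2) / 4) := by positivity
  have hB : 0 < √((1 - s) ^ 2 / 2) := by
    have : 0 < 1 - s := by linarith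
    positivity
  have key : ∀ i j, i < j → familyTan s i ≠ familyTan s j := by
    intro i j hij
    rw [← dist_pos]
    fin_cases i <;> fin_cases j <;>
      first
      | exact absurd hij (by decide)
      | exact hA.trans_eq d01.symm
      | exact hA.trans_eq d02.symm
      | exact hB.trans_eq d03.symm
      | exact hB.trans_eq d12.symm
      | exact hA.trans_eq d13.symm
      | exact hA.trans_eq d23.symm
  intro i j hij
  by_contra hne
  rcases lt_or_gt_of_ne hne with h | h
  · exact key i j h hij
  · exact key j i h hij.symm

lemma rieszEnergy_familyTan (p : ℝ) {s : ℝ} (h0 : 0 < s) (h1 : s < 1 / 2) :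
    rieszEnergy p (familyTan s) =
      4 * ((1 + s ^ 2) / 4) ^ (-p / 2) + 2 * ((1 - s) ^ 2 / 2) ^ (-p / 2) := by
  obtain ⟨d01, d02, d03, d12, d13, d23⟩ := dist_familyTan h0 h1
  have key : ∀ A : ℝ, 0 ≤ A → 1 / √A ^ p = A ^ (-p / 2) := by
    intro A hA
    rw [Real.sqrt_eq_rpow, ← Real.rpow_mul hA, one_div, ← Real.rpow_neg hA]
    congr 1; ring
  rw [rieszEnergy_four, d01, d02, d03, d12, d13, d23, key _ (by positivity), key _ (by positivity)]
  ring

lemma two_sub_sqrt_three_mem : 0 < 2 - √3 ∧ 2 - √3 < 1 / 2 := by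
  have h3 : √3 ^ 2 = 3 := Real.sq_sqrt (by norm_num)
  have h3p : 0 < √3 := by positivity
  constructor <;> nlinarith

/-- The packing `S_{π/12}` is never a minimizer: its energy decreases when `α` does. -/
theorem not_isRieszMinimizer_familyS_pi_div_twelve {p : ℝ} (hp : 0 < p) :
    ¬ IsRieszMinimizer p (familyS (Real.pi / 12)) := by
  rw [familyS_pi_div_twelve]
  rintro ⟨-, hmin⟩
  have h3 : √3 ^ 2 = 3 := Real.sq_sqrt (by norm_num)
  obtain ⟨t0, t1⟩ := two_sub_sqrt_three_mem
  set t := 2 - √3 with ht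
  set f : ℝ → ℝ := fun s =>
    4 * ((1 + s ^ 2) / 4) ^ (-p / 2) + 2 * ((1 - s) ^ 2 / 2) ^ (-p / 2) with hf
  -- Both squared distances equal `t` at `s = t`, so the two terms of the derivative share the
  -- factor `t ^ (-p / 2 - 1)`.
  have eA : (1 + t ^ 2) / 4 = t := by rw [ht]; nlinarith
  have eB : (1 - t) ^ 2 / 2 = t := by rw [ht]; nlinarith
  have hloc : IsLocalMin f t := by
    filter_upwards [Ioo_mem_nhds t0 t1] with s hs
    simp only [hf]
    rw [← rieszEnergy_familyTan p t0 t1, ← rieszEnergy_familyTan p hs.1 hs.2]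
    exact hmin _ (familyTan_injective hs.1 hs.2)
  have dA : HasDerivAt (fun s : ℝ => (1 + s ^ 2) / 4) (t / 2) t := by
    refine ((((hasDerivAt_id t).pow 2).const_add 1).div_const 4).congr_deriv ?_
    simp only [id, Nat.cast_ofNat]
    ring
  have dB : HasDerivAt (fun s : ℝ => (1 - s) ^ 2 / 2) (-(1 - t)) t := by
    refine ((((hasDerivAt_id t).const_sub 1).pow 2).div_const 2).congr_deriv ?_
    simp only [id, Nat.cast_ofNat]
    ring
  have dA' := (dA.rpow_const (p := -p / 2) (Or.inl (by rw [eA]; exact t0.ne'))).const_mul 4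
  have dB' := (dB.rpow_const (p := -p / 2) (Or.inl (by rw [eB]; exact t0.ne'))).const_mul 2
  have hzero := hloc.hasDerivAt_eq_zero (dA'.add dB')
  rw [eA, eB] at hzero
  have hpos : 0 < t ^ (-p / 2 - 1) := Real.rpow_pos_of_pos t0 _
  have hneg : p * (1 - 2 * t) * t ^ (-p / 2 - 1) = 0 := by linarith
  have : 0 < p * (1 - 2 * t) * t ^ (-p / 2 - 1) :=
    mul_pos (mul_pos hp (by linarith)) hpos
  exact this.ne' hneg

lemma dist_sq_familyS_pi_div_twelve {i j : Fin 4} (hij : i ≠ j) :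
    2 - √3 ≤ dist (familyS (Real.pi / 12) i) (familyS (Real.pi / 12) j) ^ 2 := by
  have h3 : √3 ^ 2 = 3 := Real.sq_sqrt (by norm_num)
  obtain ⟨t0, t1⟩ := two_sub_sqrt_three_mem
  rw [familyS_pi_div_twelve]
  obtain ⟨d01, d02, d03, d12, d13, d23⟩ := dist_familyTan t0 t1
  have eA : (1 + (2 - √3) ^ 2) / 4 = 2 - √3 := by nlinarith
  have eB : (1 - (2 - √3)) ^ 2 / 2 = 2 - √3 := by nlinarith
  rw [eA] at d01 d02 d13 d23
  rw [eB] at d03 d12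
  have key : ∀ i j, i < j → dist (familyTan (2 - √3) i) (familyTan (2 - √3) j) = √(2 - √3) := by
    intro i j hij
    fin_cases i <;> fin_cases j <;> first | exact absurd hij (by decide) | assumption
  rcases lt_or_gt_of_ne hij with h | h
  · rw [key _ _ h, Real.sq_sqrt t0.le]
  · rw [dist_comm, key _ _ h, Real.sq_sqrt t0.le]

/-! ### Comparison with the packing for large exponents -/

lemma rieszEnergy_of_dist_eq (p : ℝ) {d : ℝ} {x : Fin 4 → FlatTorus}
    (h : ∀ i j, i ≠ j → dist (x i) (x j) = d) : rieszEnergy p x = 6 * (1 / d ^ p) := by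
  rw [rieszEnergy_four, h _ _ (by decide), h _ _ (by decide), h _ _ (by decide),
    h _ _ (by decide), h _ _ (by decide), h _ _ (by decide)]
  ring

lemma dist_eq_of_le {x : Fin 4 → FlatTorus} (H : ∀ i j, i ≠ j → √(2 - √3) ≤ dist (x i) (x j)) :
    ∀ i j, i ≠ j → dist (x i) (x j) = √(2 - √3) := by
  intro i j hij
  have t0 := two_sub_sqrt_three_mem.1.le
  rw [← dist_sq_eq_of_le (fun i j hij => (Real.sqrt_le_left dist_nonneg).1 (H i j hij)) i j hij,
    Real.sqrt_sq dist_nonneg]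

/-- A configuration minimizes the energy only for bounded exponents. -/
theorem exists_bound_of_isRieszMinimizer (x : Fin 4 → FlatTorus) :
    ∃ P : ℝ, ∀ p : ℝ, 0 < p → IsRieszMinimizer p x → p ≤ P := by
  by_contra! hunb
  set S := familyS (Real.pi / 12) with hS
  set d := √(2 - √3) with hd
  have dpos : 0 < d := Real.sqrt_pos.2 two_sub_sqrt_three_mem.1
  have hSd : ∀ i j, i ≠ j → dist (S i) (S j) = d := dist_eq_of_le fun i j hij =>
    (Real.sqrt_le_left dist_nonneg).2 (dist_sq_familyS_pi_div_twelve hij)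
  have hSinj : Function.Injective S := fun i j hij => by
    by_contra hne
    have := hSd i j hne
    rw [hij, dist_self] at this
    exact dpos.ne this
  obtain ⟨p₀, hp₀, hx₀, -⟩ := hunb 0
  have hle : ∀ i j, i ≠ j → d ≤ dist (x i) (x j) := by
    intro i j hij
    by_contra! hlt
    have hr : 0 < dist (x i) (x j) := dist_pos.2 (hx₀.1.ne hij)
    -- For large `p` the single term of the short pair exceeds `6 / d ^ p`, the energy of all six
    -- pairs of `S`.
    obtain ⟨N, hN⟩ := Filter.eventually_atTop.1
      ((tendsto_rpow_atTop_of_base_gt_one _ ((one_lt_div hr).2 hlt)).eventually_gt_atTop 6)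
    obtain ⟨p, -, hx, hNp⟩ := hunb N
    have h1 := hN p hNp.le
    rw [Real.div_rpow dpos.le hr.le, lt_div_iff₀ (Real.rpow_pos_of_pos hr p)] at h1
    have h2 := (one_div_dist_rpow_le_rieszEnergy p x hij).trans (hx.2 S hSinj)
    rw [rieszEnergy_of_dist_eq p hSd, mul_one_div,
      div_le_div_iff₀ (Real.rpow_pos_of_pos hr p) (Real.rpow_pos_of_pos dpos p)] at h2
    linarith
  refine not_isRieszMinimizer_familyS_pi_div_twelve hp₀ ⟨hSinj, fun y hy => ?_⟩
  rw [rieszEnergy_of_dist_eq p₀ hSd, ← rieszEnergy_of_dist_eq p₀ (dist_eq_of_le hle)]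
  exact hx₀.2 y hy

end FlatTorus

theorem theorem3 :
    -- the minimum is attained for every `p > 0`
    (∀ p : ℝ, 0 < p → ∃ x : Fin 4 → FlatTorus, FlatTorus.IsRieszMinimizer p x) ∧
    -- every configuration that is a minimizer for some `p` is one only for `p` in a finite interval
    (∀ x : Fin 4 → FlatTorus, (∃ p₀ : ℝ, 0 < p₀ ∧ FlatTorus.IsRieszMinimizer p₀ x) →
      ∃ P : ℝ, ∀ p : ℝ, 0 < p → FlatTorus.IsRieszMinimizer p x → p ≤ P) ∧
    -- as `p` varies, infinitely many minimizers occur, even modulo the symmetries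
    {c : FlatTorus.ConfigurationClass 4 | ∃ (p : ℝ) (x : Fin 4 → FlatTorus), 0 < p ∧
      FlatTorus.IsRieszMinimizer p x ∧ c = Quotient.mk (FlatTorus.symmetrySetoid 4) x}.Infinite ∧
    -- the best packing `S_{π/12}` is never a minimizer
    (∀ p : ℝ, 0 < p → ¬ FlatTorus.IsRieszMinimizer p (FlatTorus.familyS (Real.pi / 12))) := by
  have hex : ∀ p : ℝ, 0 < p → ∃ x : Fin 4 → FlatTorus, FlatTorus.IsRieszMinimizer p x :=
    fun p hp => FlatTorus.exists_isRieszMinimizer hp (FlatTorus.familyTan_injective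
      FlatTorus.two_sub_sqrt_three_mem.1 FlatTorus.two_sub_sqrt_three_mem.2)
  refine ⟨hex, fun x _ => FlatTorus.exists_bound_of_isRieszMinimizer x, fun hfin => ?_,
    fun p hp => FlatTorus.not_isRieszMinimizer_familyS_pi_div_twelve hp⟩
  choose P hP using FlatTorus.exists_bound_of_isRieszMinimizer
  -- The bound is taken at the chosen representative of each class; minimality passes to it by
  -- symmetry.
  obtain ⟨B, hB⟩ := (hfin.image fun c : FlatTorus.ConfigurationClass 4 => P (Quotient.out c)).bddAbove
  obtain ⟨x, hx⟩ := hex (max B 0 + 1) (by positivity)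
  have hrel : (FlatTorus.symmetrySetoid 4).r x
      (Quotient.mk (FlatTorus.symmetrySetoid 4) x).out :=
    (FlatTorus.symmetrySetoid 4).symm (Quotient.mk_out x)
  have h1 := hP _ _ (by positivity) (hx.of_symm hrel)
  have h2 := hB (Set.mem_image_of_mem (fun c : FlatTorus.ConfigurationClass 4 => P (Quotient.out c))
    (⟨max B 0 + 1, x, by positivity, hx, rfl⟩ : _ ∈ {c : FlatTorus.ConfigurationClass 4 |
      ∃ (p : ℝ) (x : Fin 4 → FlatTorus), 0 < p ∧ FlatTorus.IsRieszMinimizer p x ∧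
        c = Quotient.mk (FlatTorus.symmetrySetoid 4) x}))
  have := le_max_left B 0
  linarith
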